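/- Let $m>2$ and let $M$ be a nonempty connected metrizable topological manifold of dimension $m$ without boundary (every point has an open neighbourhood homeomorphic to an open subset of $\mathbb R^m$). A subset $A\subseteq M$ is called *discrete* if every point $x\in M$ has a neighbourhood containing at most one point of $A$. The space $M$ is *strongly discrete homogeneous* if for any two discrete subsets $A,B\subseteq M$, every bijection $f\colon A\to B$ extends to a homeomorphism of $M$ onto itself. A *compact exhaustion* of $M$ is a sequence $(K_n)_{n\ge 0}$ of compact subsets of $M$ with $K_n\subseteq \operatorname{int}K_{n+1}$ for all $n$ and $\bigcup_n K_n=M$. An *end* of $M$ with respect to $(K_n)$ is a sequence $(Y_n)_{n\ge 0}$ such that, for every $n$, $Y_n$ is a nonempty connected component of $M\setminus K_n$ and $Y_{n+1}\subseteq Y_n$ (so a compact $M$ has no ends). Then $M$ has a compact exhaustion and, for every compact exhaustion $(K_n)$ of $M$, the manifold $M$ is strongly discrete homogeneous if and only if $M$ has at most one end with respect to $(K_n)$. -/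

import Mathlib

open Topology

/-- A subset `A` of a space `X` is discrete when the family of its singletons is a discrete family:
every point of `X` (not only of `A`) has a neighbourhood containing at most one point of `A`. -/
def IsDiscreteSubset {X : Type*} [TopologicalSpace X] (A : Set X) : Prop :=
  ∀ x : X, ∃ U ∈ 𝓝 x, (A ∩ U).Subsingleton

/-- A space is strongly discrete homogeneous if every bijection between two discrete subsets
extends to a homeomorphism of the space onto itself. -/
def StronglyDiscreteHomogeneous (X : Type*) [TopologicalSpace X] : Prop :=
  ∀ A B : Set X, IsDiscreteSubset A → IsDiscreteSubset B →
    ∀ f : A ≃ B, ∃ h : X ≃ₜ X, ∀ a : A, h (a : X) = (f a : X)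

/-- A (Freudenthal) end of `X` with respect to an exhaustion `K` of `X` by compact sets
(`K n ⊆ interior (K (n + 1))`, `⋃ n, K n = X`): a decreasing sequence whose `n`-th term is a
(nonempty) connected component of `X \ K n`. -/
structure SpaceEnd {X : Type*} [TopologicalSpace X] (K : CompactExhaustion X) where
  component : ℕ → Set X
  isComponent : ∀ n, ∃ x ∈ (K n)ᶜ, component n = connectedComponentIn (K n)ᶜ x
  decreasing : ∀ n, component (n + 1) ⊆ component n

/-- There is at most one end with respect to the exhaustion `K`. -/
def HasAtMostOneEnd {X : Type*} [TopologicalSpace X] (K : CompactExhaustion X) : Prop :=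
  ∀ E E' : SpaceEnd K, E = E'

/-! ### Sigma-compactness, and discrete sets as families tending to infinity -/

section Topology
open Set Filter

variable {X : Type*} [TopologicalSpace X]

/-! Suppose there are two ends, whose components differ at level `N`. Take a sequence `u` running to
the first end, and a sequence `b` alternating between `u` and a sequence running to the second. A
homeomorphism with `u n ↦ b n` would carry a far component of the first end to a connected set
missing `K N` but meeting two components of its complement
(`StronglyDiscreteHomogeneous.hasAtMostOneEnd`).

Conversely, König's lemma shows that every unbounded complementary component carries an end. With at
most one end, each compact set therefore lies in a compact set with connected complement
(`exists_isPreconnected_compl`). A discrete set does not disconnect a connected open set in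
dimension at least two, so finitely many points can be moved to their targets outside such a compact
set while all other marked points stay fixed (`exists_homeomorph_finset`). A back-and-forth along
the exhaustion yields homeomorphisms that stabilize on compact sets and glue
(`exists_homeomorph_of_eqOn`). This needs disjoint source and target; in general one passes through
a third family disjoint from both. -/

theorem sigmaCompactSpace_of_paracompact_connected [ParacompactSpace X]
    [WeaklyLocallyCompactSpace X] [ConnectedSpace X] : SigmaCompactSpace X := by
  choose N hN hxN using fun x : X => exists_compact_mem_nhds x
  obtain ⟨v, vo, vU, vf, vN⟩ := precise_refinement (fun x => interior (N x))
    (fun _ => isOpen_interior)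
    (iUnion_eq_univ_iff.2 fun x => ⟨x, mem_interior_iff_mem_nhds.2 (hxN x)⟩)
  have step : ∀ K : {s : Set X // IsCompact s}, ∃ K' : {s : Set X // IsCompact s},
      ∀ a, (v a ∩ K.1).Nonempty → v a ⊆ K'.1 := fun K =>
    ⟨⟨_, (vf.finite_nonempty_inter_compact K.2).isCompact_biUnion fun a _ => hN a⟩,
      fun a ha => ((vN a).trans interior_subset).trans
        (subset_biUnion_of_mem (u := fun a => N a) (show a ∈ {a | (v a ∩ K.1).Nonempty} from ha))⟩
  choose g hg using step
  obtain ⟨x₀⟩ : Nonempty X := inferInstance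
  let K : ℕ → {s : Set X // IsCompact s} := fun n => g^[n] ⟨{x₀}, isCompact_singleton⟩
  have hK : ∀ n a, (v a ∩ (K n).1).Nonempty → v a ⊆ (K (n + 1)).1 := fun n a h => by
    simp only [K, Function.iterate_succ_apply']
    exact hg _ a h
  -- A member of the cover that meets `K n` lies in `K (n + 1)`, so one that meets the union lies in
  -- it; this gives both closedness and openness.
  have hclopen : IsClopen (⋃ n, (K n).1) := by
    constructor
    · refine isClosed_of_closure_subset fun x hx => ?_
      obtain ⟨a, ha⟩ := iUnion_eq_univ_iff.1 vU x
      obtain ⟨y, hya, hy⟩ := mem_closure_iff.1 hx (v a) (vo a) ha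
      obtain ⟨n, hn⟩ := mem_iUnion.1 hy
      exact mem_iUnion.2 ⟨n + 1, hK n a ⟨y, hya, hn⟩ ha⟩
    · refine isOpen_iff_mem_nhds.2 fun x hx => ?_
      obtain ⟨a, ha⟩ := iUnion_eq_univ_iff.1 vU x
      obtain ⟨n, hn⟩ := mem_iUnion.1 hx
      exact mem_of_superset ((vo a).mem_nhds ha)
        ((hK n a ⟨x, ha, hn⟩).trans (subset_iUnion (fun n => (K n).1) (n + 1)))
  have huniv : (⋃ n, (K n).1) = univ := hclopen.eq_univ ⟨x₀, mem_iUnion.2 ⟨0, rfl⟩⟩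
  exact isSigmaCompact_univ_iff.1 ⟨fun n => (K n).1, fun n => (K n).2, huniv⟩

/-- Removing a set with dense complement from a preconnected set `V` keeps it preconnected,
provided this holds inside some neighbourhood, contained in `V`, of each point of `V`. -/
theorem IsPreconnected.diff_of_local {V E : Set X} (hV : IsPreconnected V)
    (hEd : Dense Eᶜ)
    (hloc : ∀ x ∈ V, ∃ W, IsOpen W ∧ x ∈ W ∧ W ⊆ V ∧ IsPreconnected (W \ E)) :
    IsPreconnected (V \ E) := by
  rw [isPreconnected_iff_subset_of_disjoint] at *
  intro u v hu hv huv hdisj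
  -- `f` turns a separation of `V \ E` into one of `V`: `f u` and `f v` cover `V` by the local
  -- hypothesis and are disjoint there because `Eᶜ` is dense.
  let f : Set X → Set X := fun o => {x | ∃ W, IsOpen W ∧ x ∈ W ∧ W ⊆ V ∧ W \ E ⊆ o}
  have fo : ∀ o, IsOpen (f o) := fun o => isOpen_iff_forall_mem_open.2
    fun x ⟨W, hW, hx, h1, h2⟩ => ⟨W, fun y hy => ⟨W, hW, hy, h1, h2⟩, hW, hx⟩
  have hcov : V ⊆ f u ∪ f v := fun x hx => by
    obtain ⟨W, hW, hxW, hWV, hc⟩ := hloc x hx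
    have hs : W \ E ⊆ V \ E := sdiff_subset_sdiff_left hWV
    rcases isPreconnected_iff_subset_of_disjoint.1 hc u v hu hv (hs.trans huv)
      (subset_empty_iff.1 (hdisj ▸ inter_subset_inter_left _ hs)) with h | h
    · exact Or.inl ⟨W, hW, hxW, hWV, h⟩
    · exact Or.inr ⟨W, hW, hxW, hWV, h⟩
  have hdis : V ∩ (f u ∩ f v) = ∅ := by
    refine eq_empty_of_forall_notMem ?_
    rintro x ⟨-, ⟨W, hW, hxW, hWV, hWu⟩, ⟨W', hW', hxW', -, hWv⟩⟩
    obtain ⟨y, hyE, hy⟩ := hEd.inter_open_nonempty (W ∩ W') (hW.inter hW') ⟨x, hxW, hxW'⟩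
    have : y ∈ V \ E ∩ (u ∩ v) := ⟨⟨hWV hyE.1, hy⟩, hWu ⟨hyE.1, hy⟩, hWv ⟨hyE.2, hy⟩⟩
    rw [hdisj] at this
    exact this
  refine (hV (f u) (f v) (fo u) (fo v) hcov hdis).imp ?_ ?_ <;>
  · rintro h x ⟨hx, hxE⟩
    obtain ⟨W, -, hxW, -, hWo⟩ := h hx
    exact hWo ⟨hxW, hxE⟩

/-- A family of points that tends to infinity is locally finite. -/
theorem locallyFinite_singleton_of_tendsto [WeaklyLocallyCompactSpace X] {ι : Type*} {a : ι → X}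
    (ha : Tendsto a cofinite (cocompact X)) : LocallyFinite fun i => ({a i} : Set X) := by
  intro x
  obtain ⟨K, hK, hx⟩ := exists_compact_mem_nhds x
  refine ⟨K, hx, ?_⟩
  have := ha hK.compl_mem_cocompact
  rw [mem_map, mem_cofinite] at this
  refine this.subset ?_
  rintro i ⟨y, rfl, hy⟩
  simpa using hy

theorem finite_setOf_mem_of_tendsto {ι : Type*} {a : ι → X}
    (ha : Tendsto a cofinite (cocompact X)) {K : Set X} (hK : IsCompact K) :
    {i | a i ∈ K}.Finite := by
  have := ha hK.compl_mem_cocompact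
  rw [mem_map, mem_cofinite] at this
  simpa [preimage, compl_ofPred] using this

theorem isClosed_image_of_tendsto [WeaklyLocallyCompactSpace X] [T1Space X] {ι : Type*} {a : ι → X}
    (ha : Tendsto a cofinite (cocompact X)) (s : Set ι) : IsClosed (a '' s) := by
  have : a '' s = ⋃ i : s, {a i} := by
    ext; simp [eq_comm]
  rw [this]
  exact ((locallyFinite_singleton_of_tendsto ha).comp_injective
    Subtype.val_injective).isClosed_iUnion fun _ => isClosed_singleton

theorem isDiscreteSubset_range_of_tendsto [WeaklyLocallyCompactSpace X] [T1Space X] {ι : Type*}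
    {a : ι → X} (ha : Tendsto a cofinite (cocompact X)) : IsDiscreteSubset (range a) := by
  intro x
  refine ⟨(a '' {i | a i ≠ x})ᶜ, (isClosed_image_of_tendsto ha _).isOpen_compl.mem_nhds ?_, ?_⟩
  · rintro ⟨i, hi, rfl⟩
    exact hi rfl
  · have : ∀ y ∈ range a ∩ (a '' {i | a i ≠ x})ᶜ, y = x := by
      rintro y ⟨⟨i, rfl⟩, hi⟩
      by_contra h
      exact hi ⟨i, h, rfl⟩
    exact fun y hy z hz => (this y hy).trans (this z hz).symm

/-- Finitely many neighbourhoods with at most one point of `A` each cover a compact set. Discrete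
sets thus become injective families tending to infinity, the form used in the construction. -/
theorem IsDiscreteSubset.tendsto_coe {A : Set X} (hA : IsDiscreteSubset A) :
    Tendsto ((↑) : A → X) cofinite (cocompact X) := by
  refine (hasBasis_cocompact.tendsto_right_iff).2 fun K hK => ?_
  rw [eventually_cofinite]
  simp only [mem_compl_iff, not_not]
  have : (A ∩ K).Finite := by
    choose U hU hs using hA
    obtain ⟨t, -, ht⟩ := hK.elim_nhds_subcover U fun x _ => hU x
    refine (t.finite_toSet.biUnion fun x _ => (hs x).finite).subset fun y hy => ?_
    obtain ⟨x, hx, hyx⟩ := mem_iUnion₂.1 (ht hy.2)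
    exact mem_iUnion₂.2 ⟨x, hx, hy.1, hyx⟩
  refine Finite.of_finite_image (f := ((↑) : A → X)) (this.subset ?_) Subtype.val_injective.injOn
  rintro _ ⟨y, hy, rfl⟩
  exact ⟨y.2, hy⟩

end Topology

/-! ### Moving points by compactly supported homeomorphisms -/

section Homogeneity
open Set Filter Metric

/-- Add to the identity a tent function times `y - c`. The perturbation is Lipschitz with constant
`‖y - c‖ / r < 1`, so the sum is a homeomorphism. -/
theorem exists_homeomorph_ball {E : Type*} [NormedAddCommGroup E] [NormedSpace ℝ E]
    [CompleteSpace E] {c y : E} {r : ℝ} (hy : y ∈ ball c r) :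
    ∃ φ : E ≃ₜ E, φ c = y ∧ ∀ x ∉ ball c r, φ x = x := by
  have hr : 0 < r := pos_of_mem_ball hy
  let L : ℝ := ‖y - c‖ / r
  have hL0 : 0 ≤ L := by positivity
  have hL : L < 1 := by
    rw [div_lt_one hr, ← dist_eq_norm]
    exact hy
  let f : E → E := fun x => x + max 0 (1 - dist x c / r) • (y - c)
  have hf : ApproximatesLinearOn f ((ContinuousLinearEquiv.refl ℝ E : E ≃L[ℝ] E) : E →L[ℝ] E)
      univ ⟨L, hL0⟩ := by
    intro x _ z _
    have h1 : f x - f z - ((ContinuousLinearEquiv.refl ℝ E : E ≃L[ℝ] E) : E →L[ℝ] E) (x - z) =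
        (max 0 (1 - dist x c / r) - max 0 (1 - dist z c / r)) • (y - c) := by
      simp only [f, sub_smul]
      simp
      abel
    rw [h1, norm_smul]
    have h2 : ‖max 0 (1 - dist x c / r) - max 0 (1 - dist z c / r)‖ ≤ ‖x - z‖ / r := by
      rw [Real.norm_eq_abs]
      refine (abs_max_sub_max_le_max _ _ _ _).trans (max_le (by simp; positivity) ?_)
      have : 1 - dist x c / r - (1 - dist z c / r) = (dist z c - dist x c) / r := by ring
      rw [this, abs_div, abs_of_pos hr, ← dist_eq_norm, dist_comm x z]
      gcongr
      exact abs_dist_sub_le z x c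
    calc _ ≤ ‖x - z‖ / r * ‖y - c‖ := by gcongr
      _ = L * ‖x - z‖ := by simp only [L]; ring
  refine ⟨hf.toHomeomorph f ?_, ?_, ?_⟩
  · rcases subsingleton_or_nontrivial E with h | h
    · exact Or.inl h
    · right
      have : ‖((ContinuousLinearEquiv.refl ℝ E).symm : E →L[ℝ] E)‖₊ = 1 := by
        ext
        exact ContinuousLinearMap.norm_id
      rw [this, inv_one]
      exact hL
  · change f c = y
    simp [f]
  · intro x hx
    change f x = x
    have : 1 - dist x c / r ≤ 0 := by
      rw [sub_nonpos, one_le_div hr]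
      simpa using hx
    simp [f, max_eq_left this]

/-- Extend by the identity a self-homeomorphism of the model space supported in a compact subset of
the target of a chart. -/
theorem OpenPartialHomeomorph.exists_homeomorph_conj {X Y : Type*} [TopologicalSpace X]
    [TopologicalSpace Y] [T2Space X] (e : OpenPartialHomeomorph X Y) {K : Set Y} (hK : IsCompact K)
    (hKe : K ⊆ e.target) (φ : Y ≃ₜ Y) (hφ : ∀ y ∉ K, φ y = y) :
    ∃ k : X ≃ₜ X, (∀ x ∈ e.source, k x = e.symm (φ (e x))) ∧ ∀ x ∉ e.symm '' K, k x = x := by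
  classical
  have hmaps : ∀ ψ : Y ≃ₜ Y, (∀ y ∉ K, ψ y = y) → ∀ y ∈ e.target, ψ y ∈ e.target := by
    intro ψ hψ y hy
    by_cases h : ψ y ∈ K
    · exact hKe h
    · rwa [ψ.injective (hψ _ h)]
  let F : (Y ≃ₜ Y) → X → X := fun ψ x => if x ∈ e.source then e.symm (ψ (e x)) else x
  have hFs : ∀ ψ, ∀ x ∈ e.source, F ψ x = e.symm (ψ (e x)) := fun ψ x hx => if_pos hx
  have hFc : ∀ ψ : Y ≃ₜ Y, (∀ y ∉ K, ψ y = y) → ∀ x ∉ e.symm '' K, F ψ x = x := by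
    intro ψ hψ x hx
    by_cases hxe : x ∈ e.source
    · rw [hFs ψ x hxe, hψ, e.left_inv hxe]
      exact fun h => hx ⟨_, h, e.left_inv hxe⟩
    · exact if_neg hxe
  -- Compactness of `K` makes its image closed in all of `X`, so the extension is the identity near
  -- every point outside the chart domain.
  have hcl : IsClosed (e.symm '' K) :=
    (hK.image_of_continuousOn (e.continuousOn_symm.mono hKe)).isClosed
  have hcont : ∀ ψ : Y ≃ₜ Y, (∀ y ∉ K, ψ y = y) → Continuous (F ψ) := by
    intro ψ hψ
    rw [continuous_iff_continuousAt]
    intro x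
    by_cases hxe : x ∈ e.source
    · have h1 : ContinuousAt (fun x => e.symm (ψ (e x))) x :=
        ContinuousAt.comp (g := e.symm) (f := fun x => ψ (e x))
          (e.continuousAt_symm (hmaps ψ hψ _ (e.map_source hxe)))
          (ψ.continuous.continuousAt.comp (e.continuousAt hxe))
      exact h1.congr (mem_of_superset (e.open_source.mem_nhds hxe) fun z hz => (hFs ψ z hz).symm)
    · have hx : x ∉ e.symm '' K := by
        rintro ⟨y, hy, rfl⟩
        exact hxe (e.map_target (hKe hy))
      exact continuousAt_id.congr
        (mem_of_superset (hcl.isOpen_compl.mem_nhds hx) fun z hz => (hFc ψ hψ z hz).symm)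
  have hinv : ∀ ψ : Y ≃ₜ Y, (∀ y ∉ K, ψ y = y) → ∀ x, F ψ.symm (F ψ x) = x := by
    intro ψ hψ x
    by_cases hxe : x ∈ e.source
    · have h1 := hmaps ψ hψ _ (e.map_source hxe)
      rw [hFs ψ x hxe, hFs _ _ (e.map_target h1), e.right_inv h1, ψ.symm_apply_apply,
        e.left_inv hxe]
    · simp only [F, if_neg hxe]
  have hφ' : ∀ y ∉ K, φ.symm y = y := fun y hy => by
    rw [φ.symm_apply_eq, hφ y hy]
  exact ⟨{ toFun := F φ
           invFun := F φ.symm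
           left_inv := hinv φ hφ
           right_inv := hinv φ.symm hφ'
           continuous_toFun := hcont φ hφ
           continuous_invFun := hcont φ.symm hφ' }, hFs φ, hFc φ hφ⟩

theorem exists_closedBall_subset_chartAt {E : Type*} [NormedAddCommGroup E]
    {M : Type*} [TopologicalSpace M] [ChartedSpace E M] {V : Set M} (hV : IsOpen V)
    {x : M} (hx : x ∈ V) :
    ∃ r > 0, closedBall (chartAt E x x) r ⊆ (chartAt E x).target ∧
      (chartAt E x).symm '' closedBall (chartAt E x x) r ⊆ V := by
  set e := chartAt E x
  have hxe : x ∈ e.source := mem_chart_source E x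
  have h1 : e.target ∩ e.symm ⁻¹' V ∈ 𝓝 (e x) :=
    inter_mem (e.open_target.mem_nhds (e.map_source hxe))
      ((e.continuousAt_symm (e.map_source hxe)).preimage_mem_nhds
        (by rw [e.left_inv hxe]; exact hV.mem_nhds hx))
  obtain ⟨r, hr, h⟩ := nhds_basis_closedBall.mem_iff.1 h1
  exact ⟨r, hr, fun y hy => (h hy).1, image_subset_iff.2 fun y hy => (h hy).2⟩

variable {E : Type*} [NormedAddCommGroup E] [NormedSpace ℝ E]
  {M : Type*} [TopologicalSpace M] [ChartedSpace E M]

/-- In a connected open subset of a manifold any point can be moved to any other one by a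
homeomorphism supported in that subset. -/
theorem exists_homeomorph_of_isPreconnected [FiniteDimensional ℝ E] [T2Space M] {V : Set M}
    (hV : IsOpen V)
    (hVc : IsPreconnected V) {x y : M} (hx : x ∈ V) (hy : y ∈ V) :
    ∃ k : M ≃ₜ M, k x = y ∧ ∀ z ∉ V, k z = z := by
  have : ProperSpace E := FiniteDimensional.proper ℝ E
  let R : M → M → Prop := fun x y => ∃ k : M ≃ₜ M, k x = y ∧ ∀ z ∉ V, k z = z
  have hsymm : ∀ x y, R x y → R y x := by
    rintro x y ⟨k, hk, hkV⟩
    exact ⟨k.symm, by rw [← hk, k.symm_apply_apply],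
      fun z hz => by rw [k.symm_apply_eq, hkV z hz]⟩
  have htrans : ∀ x y z, R x y → R y z → R x z := by
    rintro x y z ⟨k, hk, hkV⟩ ⟨l, hl, hlV⟩
    exact ⟨k.trans l, by simp [hk, hl], fun w hw => by simp [hkV w hw, hlV w hw]⟩
  have hloc : ∀ x ∈ V, ∀ᶠ y in 𝓝 x, R x y := by
    intro x hx
    obtain ⟨r, hr, h1, h2⟩ := exists_closedBall_subset_chartAt (E := E) hV hx
    set e := chartAt E x
    have hxe : x ∈ e.source := mem_chart_source E x
    have : ∀ᶠ y in 𝓝 x, y ∈ e.source ∧ e y ∈ ball (e x) r :=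
      (show ∀ᶠ y in 𝓝 x, y ∈ e.source from e.open_source.mem_nhds hxe).and
        ((e.continuousAt hxe) (ball_mem_nhds _ hr))
    filter_upwards [this] with y hy
    obtain ⟨φ, hφ, hφb⟩ := exists_homeomorph_ball hy.2
    obtain ⟨k, hk, hk'⟩ := e.exists_homeomorph_conj (isCompact_closedBall _ _) h1 φ
      fun y hy => hφb y fun h => hy (ball_subset_closedBall h)
    exact ⟨k, by rw [hk x hxe, hφ, e.left_inv hy.1], fun z hz => hk' z fun h => hz (h2 h)⟩
  -- Sets saturated under `R` are open in `V`; the orbit of `x` and its complement would otherwise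
  -- separate `V`.
  have hopen : ∀ S : Set M, (∀ x y, R x y → (x ∈ S ↔ y ∈ S)) → IsOpen (V ∩ S) := by
    refine fun S hS => isOpen_iff_mem_nhds.2 fun z hz => ?_
    filter_upwards [hV.mem_nhds hz.1, hloc z hz.1] with w hw hzw
    exact ⟨hw, (hS z w hzw).1 hz.2⟩
  have h1 := hopen {z | R x z} fun z w hzw =>
    ⟨fun h => htrans _ _ _ h hzw, fun h => htrans _ _ _ h (hsymm _ _ hzw)⟩
  have h2 := hopen {z | ¬ R x z} fun z w hzw => not_congr
    ⟨fun h => htrans _ _ _ h hzw, fun h => htrans _ _ _ h (hsymm _ _ hzw)⟩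
  by_contra hR
  obtain ⟨z, -, hz, hz'⟩ := hVc _ _ h1 h2 (fun z hz => (em (R x z)).imp (⟨hz, ·⟩) (⟨hz, ·⟩))
    ⟨x, hx, hx, Homeomorph.refl M, rfl, fun _ _ => rfl⟩ ⟨y, hy, hy, hR⟩
  exact hz'.2 hz.2

theorem neBot_nhdsNE_of_chartedSpace [Nontrivial E] (x : M) : NeBot (𝓝[≠] x) := by
  rw [← mem_closure_iff_nhdsWithin_neBot, _root_.mem_closure_iff]
  intro o ho hx
  obtain ⟨r, hr, h1, h2⟩ := exists_closedBall_subset_chartAt (E := E) ho hx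
  set e := chartAt E x
  obtain ⟨v, hv⟩ := (NormedSpace.sphere_nonempty (E := E) (x := e x)).2 hr.le
  refine ⟨e.symm v, h2 ⟨v, sphere_subset_closedBall hv, rfl⟩, fun h => ?_⟩
  have h3 := e.right_inv (h1 (sphere_subset_closedBall hv))
  rw [show e.symm v = x from h] at h3
  rw [← h3, mem_sphere_iff_norm, sub_self, norm_zero] at hv
  exact hr.ne hv

theorem IsDiscreteSubset.dense_compl {X : Type*} [TopologicalSpace X] [∀ x : X, NeBot (𝓝[≠] x)]
    {D : Set X} (hD : IsDiscreteSubset D) : Dense Dᶜ := by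
  intro x
  obtain ⟨U, hU, hs⟩ := hD x
  rw [mem_closure_iff_nhds]
  intro t ht
  by_cases hx : x ∈ D
  · obtain ⟨y, hy, hyx⟩ := (mem_closure_iff_nhds.1
      (mem_closure_iff_nhdsWithin_neBot.2 (inferInstance : NeBot (𝓝[≠] x)))) (t ∩ U)
      (inter_mem ht hU)
    exact ⟨y, hy.1, fun hyD => hyx (hs ⟨hyD, hy.2⟩ ⟨hx, mem_of_mem_nhds hU⟩)⟩
  · exact ⟨x, mem_of_mem_nhds ht, hx⟩

/-- The complement of a closed discrete set in a connected open subset of a manifold of dimension at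
least two is connected. -/
theorem IsPreconnected.diff_of_isDiscreteSubset (hE : 1 < Module.rank ℝ E)
    {V : Set M} (hV : IsOpen V) (hVc : IsPreconnected V)
    {D : Set M} (hD : IsClosed D) (hDd : IsDiscreteSubset D) : IsPreconnected (V \ D) := by
  have : Nontrivial E := (rank_pos_iff_nontrivial (R := ℝ)).1 (zero_lt_one.trans hE)
  have hne : ∀ x : M, NeBot (𝓝[≠] x) := neBot_nhdsNE_of_chartedSpace (E := E)
  have hnhd : ∀ x : M, ∃ U, IsOpen U ∧ x ∈ U ∧ ∀ y ∈ U, y ∈ D → y = x := by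
    intro x
    by_cases hx : x ∈ D
    · obtain ⟨U, hU, hs⟩ := hDd x
      obtain ⟨U', hU', ho, hxU⟩ := mem_nhds_iff.1 hU
      exact ⟨U', ho, hxU, fun y hy hyD => hs ⟨hyD, hU' hy⟩ ⟨hx, hU' hxU⟩⟩
    · exact ⟨Dᶜ, hD.isOpen_compl, hx, fun y hy hyD => (hy hyD).elim⟩
  refine hVc.diff_of_local hDd.dense_compl ?_
  intro x hx
  obtain ⟨U, hU, hxU, hs⟩ := hnhd x
  obtain ⟨r, hr, h1, h2⟩ := exists_closedBall_subset_chartAt (E := E) (hV.inter hU) ⟨hx, hxU⟩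
  set e := chartAt E x
  have hxe : x ∈ e.source := mem_chart_source E x
  have hb1 : ball (e x) r ⊆ e.target := ball_subset_closedBall.trans h1
  have hb2 : e.symm '' ball (e x) r ⊆ V ∩ U := (image_mono ball_subset_closedBall).trans h2
  -- The punctured ball is the image of the punctured vector space, which is connected in dimension
  -- above one.
  have hcb : IsPreconnected (ball (e x) r \ {e x}) := by
    have : ball (e x) r \ {e x} = OpenPartialHomeomorph.univBall (e x) r '' {0}ᶜ := by
      have hinj : InjOn (OpenPartialHomeomorph.univBall (e x) r) univ := by
        simpa using (OpenPartialHomeomorph.univBall (e x) r).injOn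
      rw [compl_eq_univ_sdiff, hinj.image_sdiff, univ_inter, image_singleton,
        OpenPartialHomeomorph.univBall_apply_zero]
      congr 1
      rw [← OpenPartialHomeomorph.univBall_target (e x) hr,
        ← (OpenPartialHomeomorph.univBall (e x) r).image_source_eq_target,
        OpenPartialHomeomorph.univBall_source]
    rw [this]
    exact (isConnected_compl_singleton_of_one_lt_rank hE 0).isPreconnected.image _
      (OpenPartialHomeomorph.continuous_univBall _ _).continuousOn
  refine ⟨e.symm '' ball (e x) r, e.isOpen_image_symm_of_subset_target isOpen_ball hb1,
    ⟨e x, mem_ball_self hr, e.left_inv hxe⟩, hb2.trans inter_subset_left, ?_⟩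
  have hinj : InjOn e.symm (ball (e x) r) := e.symm.injOn.mono hb1
  by_cases hxD : x ∈ D
  · have : e.symm '' ball (e x) r \ D = e.symm '' (ball (e x) r \ {e x}) := by
      rw [hinj.image_sdiff, inter_eq_right.2 (singleton_subset_iff.2 (mem_ball_self hr)), image_singleton,
        e.left_inv hxe]
      ext y
      refine and_congr_right fun hy => not_congr ⟨fun hyD => hs y (hb2 hy).2 hyD, ?_⟩
      rintro rfl
      exact hxD
    rw [this]
    exact hcb.image _ (e.continuousOn_symm.mono (sdiff_subset.trans hb1))
  · have : e.symm '' ball (e x) r \ D = e.symm '' ball (e x) r :=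
      (disjoint_left.2 fun y hy hyD => hxD (hs y (hb2 hy).2 hyD ▸ hyD)).sdiff_eq_left
    rw [this]
    exact (convex_ball _ _).isPreconnected.image _ (e.continuousOn_symm.mono hb1)

end Homogeneity

/-! ### Back-and-forth extension of bijections between discrete sets -/

section Extension
open Set Filter

theorem tendsto_sumElim_cofinite {ι κ X : Type*} {l : Filter X} {a : ι → X} {b : κ → X}
    (ha : Tendsto a cofinite l) (hb : Tendsto b cofinite l) :
    Tendsto (Sum.elim a b) cofinite l := by
  intro s hs
  have h1 := ha hs
  have h2 := hb hs
  rw [mem_map, mem_cofinite] at *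
  refine ((h1.image Sum.inl).union (h2.image Sum.inr)).subset ?_
  rintro (i | i) hi
  · exact Or.inl ⟨i, hi, rfl⟩
  · exact Or.inr ⟨i, hi, rfl⟩

theorem IsDiscreteSubset.mono {X : Type*} [TopologicalSpace X] {A B : Set X}
    (hB : IsDiscreteSubset B) (h : A ⊆ B) : IsDiscreteSubset A := fun x =>
  let ⟨U, hU, hs⟩ := hB x
  ⟨U, hU, hs.anti (inter_subset_inter_left U h)⟩

/-- Homeomorphisms that agree on an increasing sequence of sets, the interiors of which, and of
whose images, cover the space, can be glued. -/
theorem exists_homeomorph_of_eqOn {X : Type*} [TopologicalSpace X] {g : ℕ → X ≃ₜ X}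
    {P : ℕ → Set X} (hP : Monotone P) (hg : ∀ n, EqOn (g (n + 1)) (g n) (P n))
    (hcov : ∀ x, ∃ n, P n ∈ 𝓝 x) (hcov' : ∀ y, ∃ n, g n '' P n ∈ 𝓝 y) :
    ∃ h : X ≃ₜ X, ∀ n, EqOn h (g n) (P n) := by
  have hmono : ∀ n m, n ≤ m → EqOn (g m) (g n) (P n) := by
    intro n m hnm
    induction m, hnm using Nat.le_induction with
    | base => exact eqOn_refl _ _
    | succ m hnm ih => exact fun x hx => (hg m (hP hnm hx)).trans (ih hx)
  have hmono' : ∀ n m, n ≤ m → EqOn (g m).symm (g n).symm (g n '' P n) := by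
    rintro n m hnm _ ⟨x, hx, rfl⟩
    rw [(g m).symm_apply_eq, (g n).symm_apply_apply, hmono n m hnm hx]
  choose N hN using hcov
  choose N' hN' using hcov'
  let F : X → X := fun x => g (N x) x
  let G : X → X := fun y => (g (N' y)).symm y
  have hF : ∀ n, EqOn F (g n) (P n) := fun n x hx => by
    rcases le_total n (N x) with h | h
    · exact hmono _ _ h hx
    · exact (hmono _ _ h (mem_of_mem_nhds (hN x))).symm
  have hG : ∀ n, EqOn G (g n).symm (g n '' P n) := fun n x hx => by
    rcases le_total n (N' x) with h | h
    · exact hmono' _ _ h hx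
    · exact (hmono' _ _ h (mem_of_mem_nhds (hN' x))).symm
  have hGF : ∀ x, G (F x) = x := fun x => by
    have hx := mem_of_mem_nhds (hN x)
    rw [hF _ hx, hG _ (mem_image_of_mem _ hx), Homeomorph.symm_apply_apply]
  have hFG : ∀ y, F (G y) = y := fun y => by
    have hy := mem_of_mem_nhds (hN' y)
    have : (g (N' y)).symm y ∈ P (N' y) := by
      obtain ⟨x, hx, hxy⟩ := hy
      rwa [(g (N' y)).symm_apply_eq.2 hxy.symm]
    rw [hG _ hy, hF _ this, Homeomorph.apply_symm_apply]
  exact ⟨{ toFun := F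
           invFun := G
           left_inv := hGF
           right_inv := hFG
           continuous_toFun := continuous_iff_continuousAt.2 fun x =>
            (g (N x)).continuous.continuousAt.congr ((hF (N x)).symm.eventuallyEq_of_mem (hN x))
           continuous_invFun := continuous_iff_continuousAt.2 fun x =>
            (g (N' x)).symm.continuous.continuousAt.congr
              ((hG (N' x)).symm.eventuallyEq_of_mem (hN' x)) }, hF⟩

variable {E : Type*} [NormedAddCommGroup E] [NormedSpace ℝ E] [FiniteDimensional ℝ E]
  {M : Type*} [TopologicalSpace M] [ChartedSpace E M] [T2Space M] [WeaklyLocallyCompactSpace M]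
  {ι : Type*}

theorem exists_homeomorph_finset (hE : 1 < Module.rank ℝ E) {a b : ι → M}
    (ha : Function.Injective a) (hb : Function.Injective b) (hab : ∀ i j, a i = b j → i = j)
    (ha' : Tendsto a cofinite (cocompact M)) (hb' : Tendsto b cofinite (cocompact M))
    {P : Set M} (hP : IsClosed P) (hPc : IsPreconnected Pᶜ) (F : Finset ι)
    (hF : ∀ i ∈ F, a i ∉ P ∧ b i ∉ P) :
    ∃ k : M ≃ₜ M, (∀ x ∈ P, k x = x) ∧ (∀ i ∈ F, k (a i) = b i) ∧
      ∀ j ∉ F, k (a j) = a j ∧ k (b j) = b j := by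
  classical
  have hc := tendsto_sumElim_cofinite ha' hb'
  have single : ∀ i, a i ∉ P → b i ∉ P → ∃ k : M ≃ₜ M, k (a i) = b i ∧ (∀ x ∈ P, k x = x) ∧
      ∀ j ≠ i, k (a j) = a j ∧ k (b j) = b j := by
    intro i hai hbi
    -- Moving `a i` inside `Pᶜ \ D` keeps all other points of both families fixed, so successive
    -- moves do not interfere.
    let D : Set M := Sum.elim a b '' {s | s ≠ Sum.inl i ∧ s ≠ Sum.inr i}
    have hD : IsClosed D := isClosed_image_of_tendsto hc _
    have hDd : IsDiscreteSubset D :=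
      (isDiscreteSubset_range_of_tendsto hc).mono (image_subset_range _ _)
    have haD : ∀ j ≠ i, a j ∈ D := fun j hj => ⟨Sum.inl j, by simpa using hj, rfl⟩
    have hbD : ∀ j ≠ i, b j ∈ D := fun j hj => ⟨Sum.inr j, by simpa using hj, rfl⟩
    have hai' : a i ∉ D := by
      rintro ⟨j | j, hj, h⟩
      · exact hj.1 (congrArg _ (ha h))
      · exact hj.2 (congrArg _ (hab i j h.symm).symm)
    have hbi' : b i ∉ D := by
      rintro ⟨j | j, hj, h⟩
      · exact hj.1 (congrArg _ (hab j i h))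
      · exact hj.2 (congrArg _ (hb h))
    obtain ⟨k, hk, hk'⟩ := exists_homeomorph_of_isPreconnected (E := E)
      (hP.isOpen_compl.sdiff hD)
      (hPc.diff_of_isDiscreteSubset hE hP.isOpen_compl hD hDd) ⟨hai, hai'⟩ ⟨hbi, hbi'⟩
    exact ⟨k, hk, fun x hx => hk' x fun h => h.1 hx, fun j hj =>
      ⟨hk' _ fun h => h.2 (haD j hj), hk' _ fun h => h.2 (hbD j hj)⟩⟩
  induction F using Finset.induction_on with
  | empty => exact ⟨Homeomorph.refl M, by simp⟩
  | insert i F hi ih =>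
    obtain ⟨k, hk, hkF, hkc⟩ := ih fun j hj => hF j (Finset.mem_insert_of_mem hj)
    obtain ⟨hai, hbi⟩ := hF i (Finset.mem_insert_self i F)
    obtain ⟨l, hl, hlP, hlc⟩ := single i hai hbi
    refine ⟨k.trans l, fun x hx => ?_, fun j hj => ?_, fun j hj => ?_⟩
    · simp [hk x hx, hlP x hx]
    · rcases Finset.mem_insert.1 hj with rfl | hj
      · simp [(hkc j hi).1, hl]
      · have : j ≠ i := fun h => hi (h ▸ hj)
        simp [hkF j hj, (hlc j this).2]
    · rw [Finset.mem_insert, not_or] at hj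
      simp [(hkc j hj.2).1, (hkc j hj.2).2, (hlc j hj.1).1, (hlc j hj.1).2]

/-- An approximation to a homeomorphism taking each `a i` to `b i`: a homeomorphism `toHomeo` that
is to be altered only outside the compact set `dom`, and that is already right in `dom`. -/
structure PartialExtension (a b : ι → M) where
  toHomeo : M ≃ₜ M
  dom : Set M
  isCompact_dom : IsCompact dom
  isPreconnected_compl : IsPreconnected domᶜ
  map_eq : ∀ i, a i ∈ dom ∨ b i ∈ toHomeo '' dom → toHomeo (a i) = b i
  -- The target of a point still to be moved is never occupied by the image of a point with another
  -- index.
  eq_of_map_eq : ∀ i j, toHomeo (a i) = b j → i = j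

theorem Homeomorph.isPreconnected_compl_image {X : Type*} [TopologicalSpace X] (g : X ≃ₜ X)
    {P : Set X} (hP : IsPreconnected Pᶜ) : IsPreconnected (g '' P)ᶜ := by
  rw [← image_compl_eq g.bijective]
  exact hP.image _ g.continuous.continuousOn

namespace PartialExtension

variable {a b : ι → M}

/-- The inverse of a partial extension. -/
def symm (S : PartialExtension a b) : PartialExtension b a where
  toHomeo := S.toHomeo.symm
  dom := S.toHomeo '' S.dom
  isCompact_dom := S.isCompact_dom.image S.toHomeo.continuous
  isPreconnected_compl := S.toHomeo.isPreconnected_compl_image S.isPreconnected_compl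
  map_eq i h := by
    rw [← image_comp] at h
    have h' : (S.toHomeo.symm ∘ S.toHomeo) = id := by ext; simp
    rw [h', image_id] at h
    rw [Homeomorph.symm_apply_eq, S.map_eq i h.symm]
  eq_of_map_eq i j h := by
    rw [Homeomorph.symm_apply_eq] at h
    exact (S.eq_of_map_eq j i h.symm).symm

/-- Only finitely many indices have `a i` in the larger compact set `P` or `b i` in its image; the
unsettled ones are corrected by a homeomorphism fixing the image of the old domain. -/
theorem exists_extend (hE : 1 < Module.rank ℝ E)
    (hull : ∀ Q : Set M, IsCompact Q → ∃ P, IsCompact P ∧ Q ⊆ P ∧ IsPreconnected Pᶜ)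
    (ha : Function.Injective a) (hb : Function.Injective b)
    (ha' : Tendsto a cofinite (cocompact M)) (hb' : Tendsto b cofinite (cocompact M))
    (S : PartialExtension a b) {Q : Set M} (hQ : IsCompact Q) :
    ∃ S' : PartialExtension a b, S.dom ⊆ S'.dom ∧ Q ⊆ S'.dom ∧
      EqOn S'.toHomeo S.toHomeo S.dom := by
  obtain ⟨P, hP, hQP, hPc⟩ := hull _ (S.isCompact_dom.union hQ)
  set g := S.toHomeo with hg
  have hga : Tendsto (g ∘ a) cofinite (cocompact M) :=
    g.isClosedEmbedding.tendsto_cocompact.comp ha'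
  have hfin : {i | a i ∈ P ∨ b i ∈ g '' P}.Finite :=
    (finite_setOf_mem_of_tendsto ha' hP).union
      (finite_setOf_mem_of_tendsto hb' (hP.image g.continuous))
  have hfin' := hfin.subset (t := {i | (a i ∈ P ∨ b i ∈ g '' P) ∧ a i ∉ S.dom ∧
    b i ∉ g '' S.dom}) fun i hi => hi.1
  obtain ⟨k, hk, hkF, hkc⟩ := exists_homeomorph_finset hE (g.injective.comp ha) hb
    S.eq_of_map_eq hga hb' (S.isCompact_dom.image g.continuous).isClosed
    (g.isPreconnected_compl_image S.isPreconnected_compl) hfin'.toFinset (by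
      intro i hi
      rw [Finite.mem_toFinset] at hi
      exact ⟨by simpa [g.injective.mem_set_image] using hi.2.1, hi.2.2⟩)
  simp only [Finite.mem_toFinset, Function.comp_apply] at hkF hkc
  have hdone : ∀ i, a i ∈ S.dom ∨ b i ∈ g '' S.dom → k (g (a i)) = b i := by
    intro i hi
    have hgi : g (a i) = b i := S.map_eq i hi
    rw [hgi]
    refine hk _ (hi.elim (fun h => ⟨a i, h, hgi⟩) id)
  refine ⟨⟨g.trans k, P, hP, hPc, ?_, ?_⟩, subset_union_left.trans hQP,
    subset_union_right.trans hQP, fun x hx => hk _ (mem_image_of_mem g hx)⟩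
  · intro i hi
    rw [Homeomorph.trans_apply]
    by_cases hd : a i ∈ S.dom ∨ b i ∈ g '' S.dom
    · exact hdone i hd
    rw [not_or] at hd
    by_contra hne
    have hiF : ¬ ((a i ∈ P ∨ b i ∈ g '' P) ∧ a i ∉ S.dom ∧ b i ∉ g '' S.dom) :=
      fun h => hne (hkF i h)
    -- An untreated `b i` is fixed by `k`, so lying in the new image of `P` it already lay in the
    -- old one.
    refine hiF ⟨hi.imp_right ?_, hd⟩
    rintro ⟨x, hx, hxb⟩
    refine ⟨x, hx, k.injective ?_⟩
    rw [(hkc i hiF).2, ← hxb]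
    rfl
  · intro i j h
    rw [Homeomorph.trans_apply] at h
    by_cases hi : (a i ∈ P ∨ b i ∈ g '' P) ∧ a i ∉ S.dom ∧ b i ∉ g '' S.dom
    · exact hb ((hkF i hi).symm.trans h)
    · rw [(hkc i hi).1] at h
      exact S.eq_of_map_eq i j h

/-- The second extension is applied to the inverse, so that the images of the domains exhaust `M` as
well and the limit is surjective. -/
theorem exists_extend_symm (hE : 1 < Module.rank ℝ E)
    (hull : ∀ Q : Set M, IsCompact Q → ∃ P, IsCompact P ∧ Q ⊆ P ∧ IsPreconnected Pᶜ)
    (ha : Function.Injective a) (hb : Function.Injective b)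
    (ha' : Tendsto a cofinite (cocompact M)) (hb' : Tendsto b cofinite (cocompact M))
    (S : PartialExtension a b) {Q : Set M} (hQ : IsCompact Q) :
    ∃ S' : PartialExtension a b, S.dom ⊆ S'.dom ∧ Q ⊆ S'.dom ∧ Q ⊆ S'.toHomeo '' S'.dom ∧
      EqOn S'.toHomeo S.toHomeo S.dom := by
  obtain ⟨S₁, h1, h1Q, h1e⟩ := S.exists_extend hE hull ha hb ha' hb' hQ
  obtain ⟨S₂, h2, h2Q, h2e⟩ := S₁.symm.exists_extend hE hull hb ha hb' ha' hQ
  have key : ∀ x ∈ S₁.dom, S₂.toHomeo (S₁.toHomeo x) = x := fun x hx =>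
    (h2e (mem_image_of_mem S₁.toHomeo hx)).trans (S₁.toHomeo.symm_apply_apply x)
  have hsub : S₁.dom ⊆ S₂.symm.dom := fun x hx =>
    ⟨S₁.toHomeo x, h2 (mem_image_of_mem S₁.toHomeo hx), key x hx⟩
  refine ⟨S₂.symm, h1.trans hsub, h1Q.trans hsub, fun y hy => ?_, fun x hx => ?_⟩
  · exact ⟨S₂.toHomeo y, mem_image_of_mem _ (h2Q hy), S₂.toHomeo.symm_apply_apply y⟩
  · rw [← h1e hx]
    exact (S₂.toHomeo.symm_apply_eq).2 (key x (h1 hx)).symm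

end PartialExtension

theorem exists_homeomorph_of_disjoint (hE : 1 < Module.rank ℝ E) (K : CompactExhaustion M)
    [PreconnectedSpace M]
    (hull : ∀ Q : Set M, IsCompact Q → ∃ P, IsCompact P ∧ Q ⊆ P ∧ IsPreconnected Pᶜ)
    {a b : ι → M} (ha : Function.Injective a) (hb : Function.Injective b)
    (hab : ∀ i j, a i ≠ b j)
    (ha' : Tendsto a cofinite (cocompact M)) (hb' : Tendsto b cofinite (cocompact M)) :
    ∃ h : M ≃ₜ M, ∀ i, h (a i) = b i := by
  choose f hf1 hf2 hf3 hf4 using fun (S : PartialExtension a b) (n : ℕ) =>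
    S.exists_extend_symm hE hull ha hb ha' hb' (K.isCompact n)
  -- The start is the identity with empty domain, where disjointness of the families makes
  -- `eq_of_map_eq` vacuous. Stage `n + 1` absorbs `K n`.
  let S : ℕ → PartialExtension a b := fun n => Nat.rec
    ⟨Homeomorph.refl M, ∅, isCompact_empty, by simpa using isPreconnected_univ, by simp,
      fun i j h => (hab i j h).elim⟩ (fun n s => f s n) n
  have hmono : Monotone fun n => (S n).dom := monotone_nat_of_le_succ fun n => hf1 (S n) n
  obtain ⟨h, hh⟩ := exists_homeomorph_of_eqOn (g := fun n => (S n).toHomeo) hmono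
    (fun n => hf4 (S n) n)
    (fun x => let ⟨n, hn⟩ := K.exists_mem_nhds x
      ⟨n + 1, mem_of_superset hn (hf2 (S n) n)⟩)
    (fun x => let ⟨n, hn⟩ := K.exists_mem_nhds x
      ⟨n + 1, mem_of_superset hn (hf3 (S n) n)⟩)
  refine ⟨h, fun i => ?_⟩
  obtain ⟨n, hn⟩ := K.exists_mem (a i)
  have hi : a i ∈ (S (n + 1)).dom := hf2 (S n) n hn
  exact (hh (n + 1) hi).trans ((S (n + 1)).map_eq i (Or.inl hi))

theorem CompactExhaustion.tendsto_cocompact_of_strictMono {X : Type*} [TopologicalSpace X]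
    (K : CompactExhaustion X) {u : ℕ → X} (hu : StrictMono (K.find ∘ u)) :
    Tendsto u cofinite (cocompact X) := by
  rw [Nat.cofinite_eq_atTop]
  refine (hasBasis_cocompact.tendsto_right_iff).2 fun Q hQ => ?_
  obtain ⟨n, hn⟩ := K.exists_superset_of_isCompact hQ
  filter_upwards [eventually_gt_atTop n] with m hm hmQ
  exact absurd (K.mem_iff_find_le.1 (hn hmQ)) (not_le.2 (hm.trans_le (hu.le_apply)))

theorem exists_injective_tendsto_cocompact {X : Type*} [TopologicalSpace X] [T2Space X]
    [Nonempty X] [∀ x : X, NeBot (𝓝[≠] x)] (K : CompactExhaustion X) {a b : ι → X}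
    (ha : Tendsto a cofinite (cocompact X)) (hD : Dense (range a ∪ range b)ᶜ) :
    ∃ c : ι → X, Function.Injective c ∧ Tendsto c cofinite (cocompact X) ∧
      ∀ i, c i ∉ range a ∪ range b := by
  have : Countable ι := by
    have h : (⋃ n, {i | a i ∈ K n}) = univ := by
      ext i
      simpa using K.exists_mem (a i)
    rw [← countable_univ_iff, ← h]
    exact countable_iUnion fun n => (finite_setOf_mem_of_tendsto ha (K.isCompact n)).countable
  obtain ⟨e, he⟩ := exists_injective_nat ι
  rcases finite_or_infinite ι with hι | hι
  · obtain ⟨x⟩ := ‹Nonempty X›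
    have : Infinite X := (infinite_univ_iff).1 (infinite_of_mem_nhds x univ_mem)
    have hinf : (range a ∪ range b)ᶜ.Infinite :=
      ((finite_range a).union (finite_range b)).infinite_compl
    let n := hinf.natEmbedding
    exact ⟨fun i => n (e i), Subtype.val_injective.comp (n.injective.comp he),
      by simp [cofinite_eq_bot], fun i => (n (e i)).2⟩
  -- An infinite family tending to infinity leaves every `K n`, so there is always room for a new
  -- point with larger `K.find`.
  · obtain ⟨u, hu, hu'⟩ := exists_seq_of_forall_finset_exists
      (fun x => x ∉ range a ∪ range b) (fun x y => K.find x < K.find y) (by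
        intro s _
        have hfin : {i | a i ∈ K (s.sup K.find)}.Finite :=
          finite_setOf_mem_of_tendsto ha (K.isCompact _)
        obtain ⟨i, hi⟩ := hfin.infinite_compl.nonempty
        obtain ⟨y, hy, hyD⟩ := hD.inter_open_nonempty _
          (K.isCompact (s.sup K.find)).isClosed.isOpen_compl ⟨a i, hi⟩
        rw [mem_compl_iff, K.mem_iff_find_le, not_le] at hy
        exact ⟨y, hyD, fun x hx => (Finset.le_sup hx).trans_lt hy⟩)
    have hmono : StrictMono (K.find ∘ u) := fun m n h => hu' m n h
    exact ⟨u ∘ e, hmono.injective.of_comp.comp he,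
      (K.tendsto_cocompact_of_strictMono hmono).comp he.tendsto_cofinite, fun i => hu _⟩

/-- The detour through `c` covers coincidences `a i = b j` with `i ≠ j`, for which the identity is
not an admissible start. -/
theorem exists_homeomorph_of_tendsto (hE : 1 < Module.rank ℝ E) (K : CompactExhaustion M)
    [ConnectedSpace M]
    (hull : ∀ Q : Set M, IsCompact Q → ∃ P, IsCompact P ∧ Q ⊆ P ∧ IsPreconnected Pᶜ)
    {a b : ι → M} (ha : Function.Injective a) (hb : Function.Injective b)
    (ha' : Tendsto a cofinite (cocompact M)) (hb' : Tendsto b cofinite (cocompact M)) :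
    ∃ h : M ≃ₜ M, ∀ i, h (a i) = b i := by
  have : Nontrivial E := (rank_pos_iff_nontrivial (R := ℝ)).1 (zero_lt_one.trans hE)
  have : ∀ x : M, NeBot (𝓝[≠] x) := neBot_nhdsNE_of_chartedSpace (E := E)
  have hD : Dense (range a ∪ range b)ᶜ := by
    rw [← Sum.elim_range]
    exact (isDiscreteSubset_range_of_tendsto (tendsto_sumElim_cofinite ha' hb')).dense_compl
  obtain ⟨c, hc, hc', hcab⟩ := exists_injective_tendsto_cocompact K ha' hD
  obtain ⟨h₁, h1⟩ := exists_homeomorph_of_disjoint hE K hull ha hc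
    (fun i j h => hcab j (Or.inl ⟨i, h⟩)) ha' hc'
  obtain ⟨h₂, h2⟩ := exists_homeomorph_of_disjoint hE K hull hc hb
    (fun i j h => hcab i (Or.inr ⟨j, h.symm⟩)) hc' hb'
  exact ⟨h₁.trans h₂, fun i => by simp [h1, h2]⟩

end Extension

/-! ### Ends and complementary components of the exhaustion -/

section Ends
open Set Filter

theorem IsPreconnected.inter_frontier_nonempty_of_not_subset {X : Type*} [TopologicalSpace X]
    {s t : Set X} (hs : IsPreconnected s) (h : (s ∩ t).Nonempty) (h' : ¬ s ⊆ t) :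
    (s ∩ frontier t).Nonempty := by
  by_contra hne
  have hcov : s ⊆ interior t ∪ (closure t)ᶜ := fun x hx => by
    by_contra h
    rw [mem_union, not_or, mem_compl_iff, not_not] at h
    exact hne ⟨x, hx, h.2, h.1⟩
  obtain ⟨x, hx, hxt⟩ := h
  obtain ⟨y, hy, hyt⟩ := not_subset.1 h'
  obtain ⟨z, -, hz, hz'⟩ := hs _ _ isOpen_interior isClosed_closure.isOpen_compl hcov
    ⟨x, hx, (hcov hx).resolve_right fun h => h (subset_closure hxt)⟩
    ⟨y, hy, (hcov hy).resolve_left fun h => hyt (interior_subset h)⟩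
  exact hz' (interior_subset_closure hz)

namespace CompactExhaustion

variable {X : Type*} [TopologicalSpace X] (K : CompactExhaustion X)

/-- The component of the point `x` in the complement of the `n`-th set of the exhaustion. -/
def complComponent (n : ℕ) (x : X) : Set X := connectedComponentIn (K n)ᶜ x

theorem complComponent_eq {n : ℕ} {x y : X} (h : y ∈ K.complComponent n x) :
    K.complComponent n x = K.complComponent n y :=
  connectedComponentIn_eq h

theorem complComponent_anti {n m : ℕ} (h : n ≤ m) (x : X) :
    K.complComponent m x ⊆ K.complComponent n x :=
  connectedComponentIn_mono x (compl_subset_compl.2 (K.subset h))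

theorem complComponent_subset (n : ℕ) (x : X) : K.complComponent n x ⊆ (K n)ᶜ :=
  connectedComponentIn_subset _ _

theorem mem_complComponent {n : ℕ} {x : X} (hx : x ∉ K n) : x ∈ K.complComponent n x :=
  mem_connectedComponentIn hx

variable [T2Space X] [LocallyConnectedSpace X]

theorem isOpen_complComponent (n : ℕ) (x : X) : IsOpen (K.complComponent n x) :=
  (K.isCompact n).isClosed.isOpen_compl.connectedComponentIn

/-- The frontier of `K (n + 1)` is compact and misses `K n`, so finitely many components cover it,
and a component that meets `K (n + 1)` without lying in it crosses this frontier. -/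
theorem finite_complComponent [PreconnectedSpace X] (n : ℕ) :
    {C | (∃ x ∉ K n, C = K.complComponent n x) ∧ ¬ C ⊆ K (n + 1)}.Finite := by
  classical
  have hF : IsCompact (frontier (K (n + 1))) :=
    (K.isCompact _).of_isClosed_subset isClosed_frontier (K.isCompact _).isClosed.frontier_subset
  obtain ⟨t, ht⟩ := hF.elim_finite_subcover (fun x => K.complComponent n x)
    (K.isOpen_complComponent n) fun x hx =>
      mem_iUnion.2 ⟨x, K.mem_complComponent fun h => hx.2 (K.subset_interior_succ n h)⟩
  -- `univ` accounts for a component missing `K (n + 1)` altogether: it is clopen, hence the whole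
  -- space.
  refine ((t.finite_toSet.image fun x => K.complComponent n x).insert univ).subset ?_
  rintro _ ⟨⟨x, hx, rfl⟩, hC⟩
  by_cases hne : (K.complComponent n x ∩ K (n + 1)).Nonempty
  · right
    obtain ⟨y, hyx, hy⟩ :=
      isPreconnected_connectedComponentIn.inter_frontier_nonempty_of_not_subset hne hC
    obtain ⟨z, hz, hyz⟩ := mem_iUnion₂.1 (ht hy)
    exact ⟨z, hz, (K.complComponent_eq hyz).trans (K.complComponent_eq hyx).symm⟩
  · left
    refine IsClopen.eq_univ ⟨isClosed_of_closure_subset fun y hy => ?_,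
      K.isOpen_complComponent n x⟩ ⟨x, K.mem_complComponent hx⟩
    have hy1 : y ∉ interior (K (n + 1)) := by
      rw [← mem_compl_iff, ← closure_compl]
      exact closure_mono (fun z hz hzK => hne ⟨z, hz, hzK⟩) hy
    have hyn : y ∉ K n := fun h => hy1 (K.subset_interior_succ n h)
    obtain ⟨z, hzy, hzx⟩ := mem_closure_iff.1 hy _ (K.isOpen_complComponent n y)
      (K.mem_complComponent hyn)
    rw [K.complComponent_eq hzx, ← K.complComponent_eq hzy]
    exact K.mem_complComponent hyn

theorem exists_bound_complComponent [PreconnectedSpace X] (n : ℕ) :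
    ∃ N, ∀ x ∉ K n, (∃ m, K.complComponent n x ⊆ K m) → K.complComponent n x ⊆ K N := by
  choose m hm using fun C : Set X =>
    (show ∃ m, (∃ m, C ⊆ K m) → C ⊆ K m by
      by_cases h : ∃ m, C ⊆ K m
      · exact h.imp fun m hm _ => hm
      · exact ⟨0, fun h' => (h h').elim⟩)
  obtain ⟨N, hN⟩ := ((K.finite_complComponent n).image m).bddAbove
  refine ⟨max (n + 1) N, fun x hx h => ?_⟩
  by_cases hx' : K.complComponent n x ⊆ K (n + 1)
  · exact hx'.trans (K.subset (le_max_left _ _))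
  · exact (hm _ h).trans (K.subset ((hN ⟨_, ⟨⟨x, hx, rfl⟩, hx'⟩, rfl⟩).trans (le_max_right _ _)))

/-- The inductive step of König's lemma: were all the smaller components bounded, the uniform bound
would trap the large one. -/
theorem exists_unbounded_complComponent [PreconnectedSpace X] {n : ℕ} {x : X}
    (hx : ∀ m, ¬ K.complComponent n x ⊆ K m) :
    ∃ y ∈ K.complComponent n x, ∀ m, ¬ K.complComponent (n + 1) y ⊆ K m := by
  by_contra! h
  obtain ⟨N, hN⟩ := K.exists_bound_complComponent (n + 1)
  refine hx (max N (n + 1)) fun y hy => ?_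
  by_cases hyn : y ∈ K (n + 1)
  · exact K.subset (le_max_right _ _) hyn
  · exact K.subset (le_max_left _ _) (hN y hyn (h y hy) (K.mem_complComponent hyn))

theorem exists_spaceEnd [PreconnectedSpace X] {n : ℕ} {x : X}
    (hx : ∀ m, ¬ K.complComponent n x ⊆ K m) :
    ∃ E : SpaceEnd K, E.component n = K.complComponent n x := by
  choose g hg hg' using fun (j : ℕ) (y : X) =>
    (show ∃ y', ((∀ m, ¬ K.complComponent j y ⊆ K m) → y' ∈ K.complComponent j y) ∧
        ((∀ m, ¬ K.complComponent j y ⊆ K m) → ∀ m, ¬ K.complComponent (j + 1) y' ⊆ K m) by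
      by_cases h : ∀ m, ¬ K.complComponent j y ⊆ K m
      · obtain ⟨y', h1, h2⟩ := K.exists_unbounded_complComponent h
        exact ⟨y', fun _ => h1, fun _ => h2⟩
      · exact ⟨y, fun h' => (h h').elim, fun h' => (h h').elim⟩)
  -- The base point stays `x` up to level `n`, where the components contain the given unbounded one;
  -- from there on `g` chooses.
  let z : ℕ → X := fun j => Nat.rec x (fun j y => if j < n then x else g j y) j
  have hz : ∀ j, z (j + 1) = if j < n then x else g j (z j) := fun j => rfl
  have hzx : ∀ j ≤ n, z j = x := by
    rintro (_ | j) hj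
    · rfl
    · rw [hz, if_pos (Nat.lt_of_succ_le hj)]
  have hzU : ∀ j m, ¬ K.complComponent j (z j) ⊆ K m := by
    have hle : ∀ j ≤ n, ∀ m, ¬ K.complComponent j (z j) ⊆ K m := fun j hj m h => by
      rw [hzx j hj] at h
      exact hx m ((K.complComponent_anti hj x).trans h)
    intro j
    induction j with
    | zero => exact hle 0 (Nat.zero_le n)
    | succ j ih =>
      by_cases hj : j < n
      · exact hle _ hj
      · rw [hz, if_neg hj]
        exact hg' j _ ih
  have hzK : ∀ j, z j ∉ K j := fun j h => hzU j 0 (by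
    rw [complComponent, connectedComponentIn_eq_empty (by simpa using h)]
    exact empty_subset _)
  refine ⟨⟨fun j => K.complComponent j (z j), fun j => ⟨z j, hzK j, rfl⟩, fun j => ?_⟩, ?_⟩
  · by_cases hj : j < n
    · rw [hzx _ hj, hzx _ hj.le]
      exact K.complComponent_anti j.le_succ x
    · have := hg j (z j) (hzU j)
      rw [K.complComponent_eq this, hz, if_neg hj]
      exact K.complComponent_anti j.le_succ _
  · exact congrArg (K.complComponent n) (hzx n le_rfl)

/-- If there is at most one end, every compact set lies in a compact set with connected
complement. -/
theorem exists_isPreconnected_compl [PreconnectedSpace X] (hK : HasAtMostOneEnd K) {Q : Set X}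
    (hQ : IsCompact Q) : ∃ P, IsCompact P ∧ Q ⊆ P ∧ IsPreconnected Pᶜ := by
  obtain ⟨n, hn⟩ := K.exists_superset_of_isCompact hQ
  obtain ⟨N, hN⟩ := K.exists_bound_complComponent n
  have hNn : ∀ y, (∃ m, K.complComponent n y ⊆ K m) → y ∈ K (max n N) := fun y hy => by
    by_cases hyn : y ∈ K n
    · exact K.subset (le_max_left _ _) hyn
    · exact K.subset (le_max_right _ _) (hN y hyn hy (K.mem_complComponent hyn))
  by_cases h : ∃ x, ∀ m, ¬ K.complComponent n x ⊆ K m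
  -- The compact set is the complement of the unbounded component of `x`; a second unbounded
  -- component would carry a second end.
  · obtain ⟨x, hx⟩ := h
    refine ⟨(K.complComponent n x)ᶜ, ?_, fun y hy hyx => ?_, ?_⟩
    · refine (K.isCompact (max n N)).of_isClosed_subset
        (K.isOpen_complComponent n x).isClosed_compl fun y hy => hNn y ?_
      by_contra! hU
      obtain ⟨E, hE⟩ := K.exists_spaceEnd hx
      obtain ⟨E', hE'⟩ := K.exists_spaceEnd hU
      have hne : (K.complComponent n y).Nonempty :=
        nonempty_iff_ne_empty.2 fun h => hU 0 (h ▸ empty_subset _)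
      have hyn : y ∈ (K n)ᶜ := connectedComponentIn_nonempty_iff.1 hne
      apply hy
      rw [← hE, hK E E', hE']
      exact K.mem_complComponent hyn
    · exact K.complComponent_subset n x hyx (hn hy)
    · rw [compl_compl]
      exact isPreconnected_connectedComponentIn
  -- With no unbounded component the space itself is compact.
  · push Not at h
    refine ⟨univ, ?_, subset_univ _, by simpa using isPreconnected_empty⟩
    rw [← univ_subset_iff.1 fun y _ => hNn y (h y)]
    exact K.isCompact _

end CompactExhaustion

namespace SpaceEnd

variable {X : Type*} [TopologicalSpace X] {K : CompactExhaustion X}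

theorem component_anti (E : SpaceEnd K) : Antitone E.component :=
  antitone_nat_of_succ_le E.decreasing

theorem component_subset (E : SpaceEnd K) (n : ℕ) : E.component n ⊆ (K n)ᶜ := by
  obtain ⟨x, -, h⟩ := E.isComponent n
  exact h ▸ connectedComponentIn_subset _ _

theorem isPreconnected_component (E : SpaceEnd K) (n : ℕ) : IsPreconnected (E.component n) := by
  obtain ⟨x, -, h⟩ := E.isComponent n
  exact h ▸ isPreconnected_connectedComponentIn

theorem component_eq_of_mem (E : SpaceEnd K) {n : ℕ} {x : X} (hx : x ∈ E.component n) :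
    E.component n = connectedComponentIn (K n)ᶜ x := by
  obtain ⟨y, -, h⟩ := E.isComponent n
  rw [h] at hx ⊢
  exact connectedComponentIn_eq hx

theorem exists_seq (E : SpaceEnd K) (N : ℕ) :
    ∃ u : ℕ → X, StrictMono (K.find ∘ u) ∧ ∀ n, u n ∈ E.component (n + N) := by
  have hne : ∀ n, ∃ x, x ∈ E.component n := fun n => by
    obtain ⟨x, hx, h⟩ := E.isComponent n
    exact ⟨x, h ▸ mem_connectedComponentIn hx⟩
  choose p hp using fun n => hne (n + N)
  have hfind : ∀ n, n ≤ K.find (p n) := fun n => by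
    have h := E.component_subset _ (hp n)
    rw [mem_compl_iff, K.mem_iff_find_le, not_le] at h
    omega
  obtain ⟨φ, hφ, hpφ⟩ := strictMono_subseq_of_tendsto_atTop
    (u := K.find ∘ p) (tendsto_atTop_mono hfind tendsto_id)
  exact ⟨p ∘ φ, hpφ, fun n => E.component_anti (by have := hφ.le_apply (x := n); omega) (hp (φ n))⟩

end SpaceEnd

theorem StronglyDiscreteHomogeneous.hasAtMostOneEnd {X : Type*} [TopologicalSpace X] [T1Space X]
    [WeaklyLocallyCompactSpace X] (hX : StronglyDiscreteHomogeneous X) (K : CompactExhaustion X) :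
    HasAtMostOneEnd K := by
  intro E E'
  by_contra hne
  obtain ⟨N, hN⟩ : ∃ N, E.component N ≠ E'.component N := by
    by_contra! h
    cases E
    cases E'
    exact hne (by congr; exact funext h)
  obtain ⟨u, hu, huE⟩ := E.exists_seq N
  obtain ⟨v, hv, hvE⟩ := E'.exists_seq N
  have hdisj : ∀ x ∈ E.component N, x ∉ E'.component N := fun x hx hx' =>
    hN ((E.component_eq_of_mem hx).trans (E'.component_eq_of_mem hx').symm)
  have huN : ∀ n, u n ∈ E.component N := fun n => E.component_anti (Nat.le_add_left N n) (huE n)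
  have hvN : ∀ n, v n ∈ E'.component N := fun n =>
    E'.component_anti (Nat.le_add_left N n) (hvE n)
  have hui : Function.Injective u := hu.injective.of_comp
  have hvi : Function.Injective v := hv.injective.of_comp
  let b : ℕ → X := fun n => if Even n then u n else v n
  have hb : Function.Injective b := by
    intro i j hij
    by_cases hi : Even i <;> by_cases hj : Even j <;> simp only [b, hi, hj, if_true, if_false] at hij
    · exact hui hij
    · exact (hdisj _ (huN i) (hij ▸ hvN j)).elim
    · exact (hdisj _ (huN j) (hij ▸ hvN i)).elim
    · exact hvi hij
  have hu' := K.tendsto_cocompact_of_strictMono hu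
  have hb' : Tendsto b cofinite (cocompact X) :=
    hu'.if' (K.tendsto_cocompact_of_strictMono hv)
  obtain ⟨h, hh⟩ := hX _ _ (isDiscreteSubset_range_of_tendsto hu')
    (isDiscreteSubset_range_of_tendsto hb')
    ((Equiv.ofInjective u hui).symm.trans (Equiv.ofInjective b hb))
  have hub : ∀ n, h (u n) = b n := fun n => by
    have := hh ⟨u n, n, rfl⟩
    rw [Equiv.trans_apply, Equiv.ofInjective_symm_apply] at this
    exact this
  -- `K p` contains the preimage of `K N`, so `h` maps the `p`-th component of `E` off `K N`. The
  -- image contains `b (2 * p)` and `b (2 * p + 1)`, which lie in different components.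
  obtain ⟨p, hp⟩ := K.exists_superset_of_isCompact
    ((K.isCompact N).image h.symm.continuous)
  have hconn := (E.isPreconnected_component p).image h h.continuous.continuousOn
  have hsub : h '' E.component p ⊆ (K N)ᶜ := by
    rintro _ ⟨x, hx, rfl⟩ hxN
    exact E.component_subset p hx (hp ⟨h x, hxN, h.symm_apply_apply x⟩)
  have hmem : ∀ n, p ≤ n → b n ∈ h '' E.component p := fun n hn =>
    ⟨u n, E.component_anti (hn.trans (Nat.le_add_right n N)) (huE n), hub n⟩
  have h0 : b (2 * p) = u (2 * p) := if_pos (even_two_mul p)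
  have h1 : b (2 * p + 1) = v (2 * p + 1) := if_neg (by simp)
  have hm0 := hmem (2 * p) (by omega)
  have hm1 := hmem (2 * p + 1) (by omega)
  rw [h0] at hm0
  rw [h1] at hm1
  have := hconn.subset_connectedComponentIn hm0 hsub hm1
  rw [← E.component_eq_of_mem (huN _)] at this
  exact hdisj _ this (hvN _)

end Ends

theorem mainTheorem1 (m : ℕ) (hm : 2 < m) (M : Type*) [TopologicalSpace M]
    [ChartedSpace (EuclideanSpace ℝ (Fin m)) M]
    [TopologicalSpace.MetrizableSpace M] [ConnectedSpace M] :
    Nonempty (CompactExhaustion M) ∧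
      ∀ K : CompactExhaustion M, StronglyDiscreteHomogeneous M ↔ HasAtMostOneEnd K := by
  let _ := TopologicalSpace.metrizableSpaceMetric M
  have := ChartedSpace.locallyCompactSpace (EuclideanSpace ℝ (Fin m)) M
  have := ChartedSpace.locallyConnectedSpace (EuclideanSpace ℝ (Fin m)) M
  have := sigmaCompactSpace_of_paracompact_connected (X := M)
  refine ⟨⟨default⟩, fun K => ⟨fun h => h.hasAtMostOneEnd K, fun hK A B hA hB f => ?_⟩⟩
  have hE : 1 < Module.rank ℝ (EuclideanSpace ℝ (Fin m)) := by
    rw [← Module.finrank_eq_rank, finrank_euclideanSpace_fin]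
    exact_mod_cast (by omega : 1 < m)
  exact exists_homeomorph_of_tendsto hE K (fun Q hQ => K.exists_isPreconnected_compl hK hQ)
    (a := ((↑) : A → M)) (b := fun i => (f i : M)) Subtype.val_injective
    (Subtype.val_injective.comp f.injective) hA.tendsto_coe
    (hB.tendsto_coe.comp f.injective.tendsto_cofinite)
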